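/- Let $A$ be a finite totally ordered set, $A^*$ the free monoid on $A$, and $\Gamma(A)$ the set of columns on $A$; a column is identified with a subset of $A$ and with the decreasing word formed by its letters. The monoid $A^*$ acts on the left on $\Gamma(A)$ by Schensted column insertion: for a letter $x$ and a column $\gamma$, $x\cdot\gamma=\gamma\cup\{x\}$ if $x>y$ for all $y\in\gamma$, and otherwise $x\cdot\gamma=(\gamma\setminus\{y\})\cup\{x\}$ with $y=\min\{z\in\gamma: z\ge x\}$. The stylic monoid $\mathrm{Styl}(A)$ is the monoid of maps $\mu(u):\Gamma(A)\to\Gamma(A)$, $\gamma\mapsto u\cdot\gamma$, for $u\in A^*$. An $N$-tableau is a semistandard Young tableau (rows listed from bottom to top) whose rows are strictly increasing and such that each row is contained, as a set, in the row below it. The $N$-tableau $N(x)$ of $x\in\mathrm{Styl}(A)$ is obtained from any word $u=u_1\cdots u_n$ with $\mu(u)=x$ by inserting $u_1,\dots,u_n$ successively, starting from the empty tableau. To insert a letter $a$ in a tableau, add $a$ to the first row $R$ (if it is not already in $R$); if $R$ contains letters larger than $a$, then the smallest of them stays in $R$ and is also inserted in the same way in the following rows. The column-reading word of a tableau is obtained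 by reading its columns from left to right, each as a decreasing word. For a letter $c$ and a column $\gamma$, let $\gamma\cdot c=\gamma\cup\{c\}$ if no letter of $\gamma$ is $\le c$, and otherwise $\gamma\cdot c=(\gamma\setminus\{b\})\cup\{c\}$ with $b=\max\{z\in\gamma: z\le c\}$. The quiver $Q(A)$ has vertex set $\Gamma(A)$ and a labelled edge $\gamma\xrightarrow{c}\gamma\cdot c$ whenever $c\notin\gamma$ and some letter of $\gamma$ is $\le c$. The extended quiver $Q'(A)$ has the same vertices, all edges of $Q(A)$, and in addition a loop $\gamma\xrightarrow{c}\gamma$ for each column $\gamma$ and each $c\in\gamma$. The label of a path is the product of the labels of its edges. **Proposition.** Let $x\in\mathrm{Styl}(A)$, and write the column-reading word of $N(x)$ as $\gamma w$, where $\gamma$ is the first column of $N(x)$. Then there is a unique path in the extended quiver $Q'(A)$ that starts at $\gamma$ and has label $w$. -/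

import Mathlib

namespace Stylic

/-! ### Columns

A column on `A` is a strictly increasing (bottom to top) finite sequence of letters; it is identified
with the set of its letters, and with the word listing them in decreasing order. -/

section Columns

variable {A : Type*} [LinearOrder A]

/-- The word associated with a column: the decreasing product of its letters. -/
def columnWord (γ : Finset A) : FreeMonoid A :=
  FreeMonoid.ofList (γ.sort (fun a b => b ≤ a))

/-- Schensted column insertion of the letter `x` into the column `γ`: if some letter of `γ` is `≥ x`,
the smallest such letter is bumped and replaced by `x`; otherwise `x` is added. -/
def columnInsert (x : A) (γ : Finset A) : Finset A :=
  if h : (γ.filter (fun y => x ≤ y)).Nonempty then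
    insert x (γ.erase ((γ.filter (fun y => x ≤ y)).min' h))
  else insert x γ

/-- The right action of a letter `c` on a column `γ`: if some letter of `γ` is `≤ c`, the largest such
letter is bumped and replaced by `c`; otherwise `c` is added. -/
def rightAct (γ : Finset A) (c : A) : Finset A :=
  if h : (γ.filter (fun y => y ≤ c)).Nonempty then
    insert c (γ.erase ((γ.filter (fun y => y ≤ c)).max' h))
  else insert c γ

/-- The right action of `c` on `γ` is frank if `c ≥ min γ` (in particular `γ` is not empty)
and `c ∉ γ`. -/
def IsFrank (γ : Finset A) (c : A) : Prop :=
  (∃ b ∈ γ, b ≤ c) ∧ c ∉ γ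

end Columns

/-! ### The stylic monoid -/

section StylicMonoid

variable (A : Type*) [LinearOrder A]

/-- The left action of words on columns, `w ↦ (γ ↦ w · γ)`, as a homomorphism to the monoid of
endofunctions of the set of columns (under composition). -/
def leftAct : FreeMonoid A →* Function.End (Finset A) :=
  FreeMonoid.lift (fun a => (columnInsert a : Function.End (Finset A)))

/-- The stylic monoid: the monoid of endofunctions of the set of columns induced by words. -/
def Styl : Submonoid (Function.End (Finset A)) := MonoidHom.mrange (leftAct A)

/-- The canonical homomorphism from words to the stylic monoid. -/
def mu : FreeMonoid A →* Styl A := (leftAct A).mrangeRestrict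

end StylicMonoid

/-! ### Tableaux -/

section Tableaux

/-- A (semistandard Young) tableau, given by the list of its rows from bottom to top. The rows are
nonempty and weakly increasing; each row is at most as long as the row just below it and each of its
entries is strictly larger than the entry just below. -/
structure Tableau (A : Type*) [LinearOrder A] where
  /-- The rows, from bottom to top. -/
  rows : List (List A)
  ne_nil : ∀ R ∈ rows, R ≠ []
  row_weak : ∀ R ∈ rows, R.Pairwise (· ≤ ·)
  length_le : rows.IsChain (fun R S => S.length ≤ R.length)
  col_strict : rows.IsChain (fun R S => ∀ (j : ℕ) (a b : A), R[j]? = some a → S[j]? = some b → a < b)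

variable {A : Type*} [LinearOrder A]

/-- The number of columns of a tableau: the length of its bottom row. -/
def Tableau.width (T : Tableau A) : ℕ := (T.rows.headD []).length

/-- The `j`-th column of a tableau (starting with `j = 0`), as a set of letters. -/
def Tableau.column (T : Tableau A) (j : ℕ) : Finset A :=
  (T.rows.filterMap (fun R => R[j]?)).toFinset

/-- The first column (the empty column if the tableau is empty). -/
def Tableau.firstColumn (T : Tableau A) : Finset A := T.column 0

/-- The column-reading word: the columns are read from left to right, each as a decreasing word. -/
def Tableau.columnReading (T : Tableau A) : FreeMonoid A :=
  ((List.range T.width).map (fun j => columnWord (T.column j))).prod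

/-- An `N`-tableau is a tableau whose rows are strictly increasing and such that each row is contained
in the row just below it. -/
structure NTableau (A : Type*) [LinearOrder A] extends Tableau A where
  row_strict : ∀ R ∈ rows, R.Pairwise (· < ·)
  nested : rows.IsChain (fun R S => S ⊆ R)

/-- Adding the letter `x` to a strictly increasing row, unless it is already there. -/
def rowAdd (x : A) (R : List A) : List A :=
  if x ∈ R then R else R.orderedInsert (· ≤ ·) x

/-- Right `N`-insertion of a letter `x` in a list of rows (from bottom to top): `x` is added to the first
row `R`; if `R` has a letter larger than `x`, the smallest such letter is inserted
in the same way in the following rows (and, in contrast with Schensted row insertion, it also stays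
in `R`). -/
def nInsert : List (List A) → A → List (List A)
  | [], x => [[x]]
  | R :: T, x =>
    match R.find? (fun y => decide (x < y)) with
    | none => rowAdd x R :: T
    | some y => rowAdd x R :: nInsert T y

/-- The rows of the `N`-tableau of a word: its letters are successively inserted, from left to right,
starting with the empty tableau. -/
def nRows (w : FreeMonoid A) : List (List A) := w.toList.foldl nInsert []

theorem mem_rowAdd {x z : A} {R : List A} : z ∈ rowAdd x R ↔ z = x ∨ z ∈ R := by
  unfold rowAdd
  split_ifs with h
  · constructor
    · exact Or.inr
    · rintro (rfl | h') <;> assumption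
  · simp

theorem rowAdd_pairwise {x : A} {R : List A} (hR : R.Pairwise (· < ·)) :
    (rowAdd x R).Pairwise (· < ·) := by
  unfold rowAdd
  split_ifs with h
  · exact hR
  · have h1 : (R.orderedInsert (· ≤ ·) x).Pairwise (· ≤ ·) :=
      List.Pairwise.orderedInsert x R (hR.imp le_of_lt)
    have h2 : (R.orderedInsert (· ≤ ·) x).Nodup :=
      (List.perm_orderedInsert (· ≤ ·) x R).nodup_iff.2
        (List.nodup_cons.2 ⟨h, hR.imp ne_of_lt⟩)
    exact h1.imp₂ (fun a b hab hne => lt_of_le_of_ne hab hne) h2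

/-- The relation between two consecutive rows that characterizes `N`-tableaux. -/
def RowRel (R S : List A) : Prop := ∀ s ∈ S, s ∈ R ∧ ∃ r ∈ R, r < s

/-- The invariant of the `N`-insertion. -/
def GoodRows (T : List (List A)) : Prop :=
  (∀ R ∈ T, R ≠ [] ∧ R.Pairwise (· < ·)) ∧ T.IsChain RowRel

theorem nInsert_head (T : List (List A)) (x : A) :
    ∃ T', nInsert T x = rowAdd x (T.headD []) :: T' := by
  cases T with
  | nil => exact ⟨[], by simp [nInsert, rowAdd]⟩
  | cons R T =>
    rw [nInsert]
    cases R.find? (fun y => decide (x < y)) with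
    | none => exact ⟨_, rfl⟩
    | some y => exact ⟨_, rfl⟩

theorem goodRows_nInsert (T : List (List A)) (x : A) (hT : GoodRows T) :
    GoodRows (nInsert T x) := by
  induction T generalizing x with
  | nil => simp [GoodRows, nInsert]
  | cons R T ih =>
    obtain ⟨h1, h2⟩ := hT
    have hR := h1 R (by simp)
    have hT : GoodRows T := ⟨fun S hS => h1 S (by simp [hS]), h2.tail⟩
    have hne : rowAdd x R ≠ [] := List.ne_nil_of_mem (mem_rowAdd.2 (Or.inl rfl))
    have hst := rowAdd_pairwise (x := x) hR.2
    rw [List.isChain_cons] at h2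
    rw [nInsert]
    cases hf : R.find? (fun y => decide (x < y)) with
    | none =>
      refine ⟨?_, List.isChain_cons.2 ⟨?_, hT.2⟩⟩
      · intro S hS
        rcases List.mem_cons.1 hS with rfl | hS
        · exact ⟨hne, hst⟩
        · exact hT.1 S hS
      · intro S hS s hs
        obtain ⟨h3, r, hr, hrs⟩ := h2.1 S hS s hs
        exact ⟨mem_rowAdd.2 (Or.inr h3), r, mem_rowAdd.2 (Or.inr hr), hrs⟩
    | some y =>
      have hy : x < y := by simpa using List.find?_some hf
      have hyR : y ∈ R := List.mem_of_find?_eq_some hf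
      have hg := ih y hT
      refine ⟨?_, List.isChain_cons.2 ⟨?_, hg.2⟩⟩
      · intro S hS
        rcases List.mem_cons.1 hS with rfl | hS
        · exact ⟨hne, hst⟩
        · exact hg.1 S hS
      · intro S hS s hs
        obtain ⟨T', hT'⟩ := nInsert_head T y
        have hS' : rowAdd y (T.headD []) = S := by simpa [hT'] using hS
        rw [← hS', mem_rowAdd] at hs
        rcases hs with rfl | hs
        · exact ⟨mem_rowAdd.2 (Or.inr hyR), x, mem_rowAdd.2 (Or.inl rfl), hy⟩
        · cases T with
          | nil => simp at hs
          | cons R' T =>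
            obtain ⟨h3, r, hr, hrs⟩ := h2.1 R' (by simp) s (by simpa using hs)
            exact ⟨mem_rowAdd.2 (Or.inr h3), r, mem_rowAdd.2 (Or.inr hr), hrs⟩

theorem goodRows_nRows (w : FreeMonoid A) : GoodRows (nRows w) := by
  have key : ∀ (l : List A) (T : List (List A)), GoodRows T → GoodRows (l.foldl nInsert T) := by
    intro l
    induction l with
    | nil => exact fun T hT => hT
    | cons x l ih => exact fun T hT => ih _ (goodRows_nInsert T x hT)
  exact key _ [] (by simp [GoodRows])

theorem RowRel.sublist {R S : List A} (hR : R.Pairwise (· < ·)) (hS : S.Pairwise (· < ·))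
    (h : RowRel R S) : List.Sublist S R.tail := by
  cases R with
  | nil =>
    cases S with
    | nil => simp
    | cons s S => simpa using (h s (by simp)).1
  | cons m R =>
    rw [List.pairwise_cons] at hR
    have hsub : S ⊆ R := by
      intro s hs
      obtain ⟨h3, r, hr, hrs⟩ := h s hs
      rcases List.mem_cons.1 h3 with rfl | h3
      · rcases List.mem_cons.1 hr with rfl | hr
        · exact absurd hrs (lt_irrefl _)
        · exact absurd hrs (hR.1 r hr).asymm
      · exact h3
    exact List.sublist_of_subperm_of_pairwise
      (List.subperm_of_subset (hS.imp ne_of_lt) hsub) hS hR.2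

theorem lt_of_sublist_tail {R S : List A} (hR : R.Pairwise (· < ·)) (h : List.Sublist S R.tail)
    (j : ℕ) (a b : A) (ha : R[j]? = some a) (hb : S[j]? = some b) : a < b := by
  induction R generalizing S j with
  | nil => simp at ha
  | cons m R ih =>
    rw [List.pairwise_cons] at hR
    cases S with
    | nil => simp at hb
    | cons s S =>
      cases j with
      | zero =>
        simp only [List.getElem?_cons_zero, Option.some.injEq] at ha hb
        subst ha hb
        exact hR.1 _ (h.subset (by simp))
      | succ j =>
        rw [List.getElem?_cons_succ] at ha hb
        exact ih hR.2 (by simpa using h.tail) j ha hb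

/-- The `N`-tableau of a word. -/
def N (w : FreeMonoid A) : NTableau A where
  rows := nRows w
  ne_nil := fun R hR => ((goodRows_nRows w).1 R hR).1
  row_weak := fun R hR => ((goodRows_nRows w).1 R hR).2.imp le_of_lt
  length_le := (goodRows_nRows w).2.imp_of_mem_imp (fun R S hR hS h => by
    have h1 := ((goodRows_nRows w).1 R hR).2
    have h2 := ((goodRows_nRows w).1 S hS).2
    exact (h.sublist h1 h2).length_le.trans R.tail_sublist.length_le)
  col_strict := (goodRows_nRows w).2.imp_of_mem_imp (fun R S hR hS h => by
    have h1 := ((goodRows_nRows w).1 R hR).2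
    have h2 := ((goodRows_nRows w).1 S hS).2
    exact lt_of_sublist_tail h1 (h.sublist h1 h2))
  row_strict := fun R hR => ((goodRows_nRows w).1 R hR).2
  nested := (goodRows_nRows w).2.imp (fun _ _ h s hs => (h s hs).1)

end Tableaux

/-! ### The quivers -/

section Quivers

/-- The vertices of the quiver `Q(A)`: the columns on `A`. -/
def Q (A : Type*) : Type _ := Finset A

/-- The vertices of the extended quiver `Q'(A)`: the columns on `A`. -/
def Q' (A : Type*) : Type _ := Finset A

variable {A : Type*} [LinearOrder A]

/-- The edges `γ → δ` in `Q(A)`: letters `c` whose right action on `γ` is frank, with `γ · c = δ`. -/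
instance instQuiverQ : Quiver (Q A) where
  Hom γ δ := {c : A // IsFrank (A := A) γ c ∧ rightAct (A := A) γ c = δ}

/-- The label of an edge of `Q(A)`. -/
def edgeLabel {γ δ : Q A} (e : γ ⟶ δ) : A := e.1

/-- The edges of `Q'(A)`: those of `Q(A)`, and a loop `γ → γ` with label `c` for each `c ∈ γ`. -/
inductive ExtEdge : Finset A → Finset A → Type _
  | old {γ δ : Finset A} (e : @Quiver.Hom (Q A) _ γ δ) : ExtEdge γ δ
  | loop {γ : Finset A} (c : A) (hc : c ∈ γ) : ExtEdge γ γ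

/-- The extended quiver. -/
instance instQuiverQ' : Quiver (Q' A) where
  Hom γ δ := ExtEdge (A := A) γ δ

/-- The label of an edge of `Q'(A)`. -/
def extEdgeLabel : {γ δ : Finset A} → ExtEdge γ δ → A
  | _, _, ExtEdge.old e => edgeLabel e
  | _, _, ExtEdge.loop c _ => c

/-- The label of a path of `Q'(A)`: the product of the labels of its edges. -/
def pathLabel {γ : Q' A} : {δ : Q' A} → Quiver.Path γ δ → FreeMonoid A
  | _, Quiver.Path.nil => 1
  | _, Quiver.Path.cons p e => pathLabel p * FreeMonoid.of (extEdgeLabel e)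

end Quivers

end Stylic

namespace Stylic

/-! ### Dominance between columns -/

section Dominance

variable {A : Type*} [LinearOrder A]

/-! Uniqueness holds because `Q'(A)` is deterministic: at a column `γ`, a letter in `γ` labels only
the loop, and a letter outside `γ` labels at most the edge to `rightAct γ c`. A path is thus
determined by its start and its label.

Existence says that reading `w` from the first column never gets stuck. The invariant is that the
current column dominates the column `D` being read. Dominance gives every `c ∈ D` a letter `≤ c` in
the current column, so `c` labels a loop or a frank edge, and `Dominates.rightAct` shows that the
edge preserves dominance over the same `D`. To pass to the next column of the tableau,
`Tableau.dominates_column_succ` (rows increase weakly) is combined with transitivity. The argument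
applies to every semistandard tableau. -/

/-- `δ` dominates `D` if, for every `t`, it has at least as many letters `≤ t` as `D`. -/
def Dominates (δ D : Finset A) : Prop :=
  ∀ t, (D.filter (· ≤ t)).card ≤ (δ.filter (· ≤ t)).card

theorem Dominates.trans {γ δ ε : Finset A} (h : Dominates γ δ) (h' : Dominates δ ε) :
    Dominates γ ε := fun t => (h' t).trans (h t)

theorem Dominates.exists_le {δ D : Finset A} (h : Dominates δ D) {c : A} (hc : c ∈ D) :
    ∃ b ∈ δ, b ≤ c := by
  have h1 : 0 < (D.filter (· ≤ c)).card := Finset.card_pos.2 ⟨c, by simp [hc]⟩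
  obtain ⟨b, hb⟩ := Finset.card_pos.1 (h1.trans_le (h c))
  exact ⟨b, (Finset.mem_filter.1 hb).1, (Finset.mem_filter.1 hb).2⟩

/-- Replacing the bumped letter `b` by `c` lowers the count of letters `≤ t` only for `b ≤ t < c`,
and then by one. There `δ` has no letter in `(t, c]`, while `D` has `c`, so the inequality at `c`
leaves one unit to spare at `t`. -/
theorem Dominates.rightAct {δ D : Finset A} (h : Dominates δ D) {c : A} (hc : c ∈ D)
    (hcδ : c ∉ δ) : Dominates (rightAct δ c) D := by
  have hne : (δ.filter (fun y => y ≤ c)).Nonempty := by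
    obtain ⟨b, hb, hbc⟩ := h.exists_le hc
    exact ⟨b, by simp [hb, hbc]⟩
  rw [Stylic.rightAct, dif_pos hne]
  set b := (δ.filter (fun y => y ≤ c)).max' hne with hb
  have hbmem := Finset.max'_mem _ hne
  rw [← hb, Finset.mem_filter] at hbmem
  have hmax : ∀ z ∈ δ, z ≤ c → z ≤ b := fun z hz hzc =>
    Finset.le_max' _ z (by simp [hz, hzc])
  intro t
  rcases le_or_gt c t with hct | htc
  · have h1 : (insert c (δ.erase b)).filter (· ≤ t) = insert c ((δ.filter (· ≤ t)).erase b) := by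
      rw [Finset.filter_insert, if_pos hct, Finset.filter_erase]
    rw [h1, Finset.card_insert_of_notMem (by simp [hcδ]),
      Finset.card_erase_add_one (by simp [hbmem.1, hbmem.2.trans hct])]
    exact h t
  · have h1 : (insert c (δ.erase b)).filter (· ≤ t) = (δ.filter (· ≤ t)).erase b := by
      rw [Finset.filter_insert, if_neg htc.not_ge, Finset.filter_erase]
    rw [h1]
    rcases le_or_gt b t with hbt | htb
    · have h2 : δ.filter (· ≤ c) = δ.filter (· ≤ t) := by
        ext z
        simp only [Finset.mem_filter]
        exact ⟨fun hz => ⟨hz.1, (hmax z hz.1 hz.2).trans hbt⟩,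
          fun hz => ⟨hz.1, hz.2.trans htc.le⟩⟩
      have h3 : (D.filter (· ≤ t)).card < (D.filter (· ≤ c)).card := by
        refine Finset.card_lt_card (Finset.ssubset_iff_of_subset ?_ |>.2 ⟨c, ?_, ?_⟩)
        · exact Finset.monotone_filter_right _ fun z _ hz => hz.trans htc.le
        · simp [hc]
        · simp [htc]
      have h4 := h c
      rw [h2] at h4
      rw [Finset.card_erase_of_mem (by simp [hbmem.1, hbt])]
      omega
    · rw [Finset.erase_eq_of_notMem (by simp [htb])]
      exact h t

end Dominance

/-! ### Determinism and existence of paths -/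

section Paths

variable {A : Type*} [LinearOrder A]

theorem pathLabel_comp {γ δ ε : Q' A} (p : Quiver.Path γ δ) (q : Quiver.Path δ ε) :
    pathLabel (p.comp q) = pathLabel p * pathLabel q := by
  induction q with
  | nil => simp [pathLabel]
  | cons q e ih => simp [pathLabel, ih, mul_assoc]

/-- Frank edges have labels outside `γ` and loops have labels in `γ`, so the label decides the kind
of edge and then its target. The sigma type allows comparing edges whose targets are not yet known
to agree. -/
theorem extEdge_target_eq {γ δ ε : Finset A} (e : ExtEdge γ δ) (f : ExtEdge γ ε)
    (h : extEdgeLabel e = extEdgeLabel f) :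
    (⟨δ, e⟩ : Σ δ, ExtEdge γ δ) = ⟨ε, f⟩ := by
  cases e with
  | old e =>
    obtain ⟨c, hc, rfl⟩ := e
    cases f with
    | old f =>
      obtain ⟨d, hd, rfl⟩ := f
      obtain rfl : c = d := h
      rfl
    | loop d hd =>
      obtain rfl : c = d := h
      exact absurd hd hc.2
  | loop c hc =>
    cases f with
    | old f =>
      obtain ⟨d, hd, rfl⟩ := f
      obtain rfl : c = d := h
      exact absurd hc hd.2
    | loop d hd =>
      obtain rfl : c = d := h
      rfl

theorem path_eq_of_pathLabel_eq {γ δ ε : Q' A} (p : Quiver.Path γ δ) (q : Quiver.Path γ ε)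
    (h : pathLabel p = pathLabel q) :
    (⟨δ, p⟩ : Σ δ : Q' A, Quiver.Path γ δ) = ⟨ε, q⟩ := by
  induction p generalizing ε with
  | nil =>
    cases q with
    | nil => rfl
    | cons q f =>
      have := congrArg FreeMonoid.toList h
      simp [pathLabel] at this
  | cons p e ih =>
    cases q with
    | nil =>
      have := congrArg FreeMonoid.toList h
      simp [pathLabel] at this
    | cons q f =>
      have h' := congrArg FreeMonoid.toList h
      simp only [pathLabel, FreeMonoid.toList_mul, FreeMonoid.toList_of] at h'
      -- Both labels end in a single letter, so the last letters agree and so do the remaining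
      -- prefixes.
      obtain ⟨h1, h2⟩ := List.append_inj' h' rfl
      obtain ⟨rfl, h3⟩ := Sigma.mk.inj_iff.1 (ih q (FreeMonoid.toList.injective h1))
      obtain rfl := eq_of_heq h3
      obtain ⟨rfl, h4⟩ := Sigma.mk.inj_iff.1 (extEdge_target_eq e f (List.singleton_inj.1 h2))
      obtain rfl := eq_of_heq h4
      rfl

theorem Dominates.exists_edge {δ D : Finset A} (h : Dominates δ D) {c : A} (hc : c ∈ D) :
    ∃ (ε : Finset A) (e : ExtEdge δ ε), extEdgeLabel e = c ∧ Dominates ε D := by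
  by_cases hcδ : c ∈ δ
  · exact ⟨δ, .loop c hcδ, rfl, h⟩
  · exact ⟨_, .old ⟨c, ⟨h.exists_le hc, hcδ⟩, rfl⟩, rfl, h.rightAct hc hcδ⟩

/-- Dominance over `D` survives each letter, so the letters of `D` may be read in any order, even
with repetitions. -/
theorem Dominates.exists_path {D : Finset A} (l : List A) (hl : ∀ c ∈ l, c ∈ D) {δ : Q' A}
    (h : Dominates (A := A) δ D) :
    ∃ (ε : Q' A) (p : Quiver.Path δ ε), pathLabel p = FreeMonoid.ofList l ∧
      Dominates (A := A) ε D := by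
  induction l generalizing δ with
  | nil => exact ⟨δ, .nil, rfl, h⟩
  | cons c l ih =>
    obtain ⟨ε, e, he, hε⟩ := h.exists_edge (hl c (by simp))
    obtain ⟨ζ, p, hp, hζ⟩ := ih (fun d hd => hl d (by simp [hd])) (δ := ε) hε
    let f : (δ : Q' A) ⟶ (ε : Q' A) := e
    have hf : pathLabel (Quiver.Path.nil.cons f) = FreeMonoid.of c :=
      (one_mul _).trans (congrArg FreeMonoid.of he)
    exact ⟨ζ, (Quiver.Path.nil.cons f).comp p,
      (pathLabel_comp _ _).trans (congrArg₂ (· * ·) hf hp), hζ⟩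

end Paths

/-! ### Columns of a tableau -/

section TableauColumns

variable {A : Type*} [LinearOrder A]

/-- This lets letters of a column, a `Finset`, be counted row by row in a list. -/
theorem Tableau.nodup_filterMap_getElem? (T : Tableau A) (j : ℕ) :
    (T.rows.filterMap (fun R => R[j]?)).Nodup := by
  -- Strictness along columns is not transitive by itself, since the middle row might be too short
  -- to have a `j`-th entry; the length condition supplies that entry.
  let r : List A → List A → Prop := fun R S => S.length ≤ R.length ∧
    ∀ (j : ℕ) (a b : A), R[j]? = some a → S[j]? = some b → a < b
  have htrans : IsTrans (List A) r := ⟨by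
    rintro R S U ⟨h1, h2⟩ ⟨h3, h4⟩
    refine ⟨h3.trans h1, fun j a b ha hb => ?_⟩
    have hj : j < S.length := (List.getElem?_eq_some_iff.1 hb).1.trans_le h3
    exact (h2 j a _ ha (List.getElem?_eq_getElem hj)).trans
      (h4 j _ b (List.getElem?_eq_getElem hj) hb)⟩
  have hchain : T.rows.IsChain r := by
    have h1 := List.isChain_iff_getElem.1 T.length_le
    have h2 := List.isChain_iff_getElem.1 T.col_strict
    exact List.isChain_iff_getElem.2 fun i hi => ⟨h1 i hi, h2 i hi⟩
  have hpw : T.rows.Pairwise r := hchain.pairwise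
  rw [List.Nodup, List.pairwise_filterMap]
  exact hpw.imp fun h a ha b hb => (h.2 j a b ha hb).ne

/-- Each row with an entry `≤ t` in column `j + 1` also has one in column `j`, because rows increase
weakly. -/
theorem Tableau.dominates_column_succ (T : Tableau A) (j : ℕ) :
    Dominates (T.column j) (T.column (j + 1)) := by
  intro t
  have hcard : ∀ j, ((T.column j).filter (· ≤ t)).card =
      ((T.rows.filterMap (fun R => R[j]?)).filter (· ≤ t)).length := by
    intro j
    rw [← List.toFinset_card_of_nodup ((T.nodup_filterMap_getElem? j).filter _),
      List.toFinset_filter]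
    simp [Tableau.column]
  rw [hcard, hcard, ← List.countP_eq_length_filter, ← List.countP_eq_length_filter,
    List.countP_filterMap, List.countP_filterMap]
  refine List.countP_mono_left fun R hR h => ?_
  have hw := List.pairwise_iff_getElem.1 (T.row_weak R hR)
  by_cases hj : j + 1 < R.length
  · have h1 : R[j] ≤ R[j + 1] := hw j (j + 1) (by omega) hj (by omega)
    rw [List.getElem?_eq_getElem hj] at h
    rw [List.getElem?_eq_getElem (by omega : j < R.length)]
    simp only [Option.map_some, Option.getD_some, decide_eq_true_eq] at h ⊢
    exact h1.trans h
  -- A row too short to reach column `j + 1` contributes nothing to its count.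
  · rw [List.getElem?_eq_none (by omega)] at h
    simp at h

/-- The dominance clause is what carries the induction: it starts from the first column dominating
itself. -/
theorem Tableau.exists_path (T : Tableau A) (n : ℕ) :
    ∃ (δ : Q' A) (p : @Quiver.Path (Q' A) _ T.firstColumn δ),
      pathLabel p = ((List.range n).map (fun j => columnWord (T.column (j + 1)))).prod ∧
      Dominates (A := A) δ (T.column n) := by
  induction n with
  | zero => exact ⟨T.firstColumn, .nil, rfl, fun _ => le_rfl⟩
  | succ n ih =>
    obtain ⟨δ, p, hp, hδ⟩ := ih
    obtain ⟨ε, q, hq, hε⟩ := (hδ.trans (T.dominates_column_succ n)).exists_path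
      ((T.column (n + 1)).sort (fun a b => b ≤ a)) (by simp)
    refine ⟨ε, p.comp q, (pathLabel_comp p q).trans ((congrArg₂ (· * ·) hp hq).trans ?_), hε⟩
    simp [columnWord, List.range_succ]

theorem Tableau.columnReading_eq (T : Tableau A) :
    T.columnReading = columnWord T.firstColumn *
      ((List.range (T.width - 1)).map (fun j => columnWord (T.column (j + 1)))).prod := by
  obtain hw | ⟨n, hn⟩ : T.width = 0 ∨ ∃ n, T.width = n + 1 := by
    cases T.width <;> simp
  -- Rows are nonempty, so width `0` forces the empty tableau; the truncated `T.width - 1` is then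
  -- `0` and all words are empty.
  · have hrows : T.rows = [] := by
      cases h : T.rows with
      | nil => rfl
      | cons R rows =>
        have hR : R = [] := by simpa [Tableau.width, h] using hw
        exact absurd hR (T.ne_nil R (by simp [h]))
    simp [Tableau.columnReading, hw, Tableau.firstColumn, Tableau.column, hrows, columnWord]
  · simp [Tableau.columnReading, hn, List.range_succ_eq_map, Tableau.firstColumn,
      Function.comp_def]

theorem Tableau.existsUnique_path (T : Tableau A) :
    ∃ w : FreeMonoid A, T.columnReading = columnWord T.firstColumn * w ∧
      ∃! p : (Σ δ : Q' A, @Quiver.Path (Q' A) _ T.firstColumn δ), pathLabel p.2 = w := by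
  refine ⟨_, T.columnReading_eq, ?_⟩
  obtain ⟨δ, p, hp, -⟩ := T.exists_path (T.width - 1)
  exact ⟨⟨δ, p⟩, hp, fun q hq => path_eq_of_pathLabel_eq q.2 p (hq.trans hp.symm)⟩

end TableauColumns

end Stylic

/-- For every `x` in the stylic monoid and every word `u` representing `x` (so that `N u` is the
`N`-tableau of `x`), the column-reading word of the `N`-tableau factors as `γ w`, with `γ` its first
column, and exactly one path of the extended quiver starts at `γ` and has label `w`. -/
theorem proposition4 {A : Type*} [LinearOrder A] [Fintype A] (x : Stylic.Styl A)
    (u : FreeMonoid A) (hu : Stylic.mu A u = x) :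
    ∃ w : FreeMonoid A,
      (Stylic.N u).columnReading = Stylic.columnWord (Stylic.N u).firstColumn * w ∧
      ∃! p : (Σ δ : Stylic.Q' A, @Quiver.Path (Stylic.Q' A) _ (Stylic.N u).firstColumn δ),
        Stylic.pathLabel p.2 = w := by
  exact (Stylic.N u).toTableau.existsUnique_path
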